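/- Let $q\ge 0$ and $n\ge 1$ be integers. In the $(q:1)$ Waiter-Client game on $E(K_n)$, in every round Waiter offers Client $q+1$ previously unclaimed edges of $K_n$; Client keeps one of them, and the remaining $q$ are claimed by Waiter. If at some point fewer than $q+1$ unclaimed edges remain, Waiter claims all of them and the game ends. At any moment, Client's graph $G_C$ consists of all $n$ vertices of $K_n$ and all edges claimed by Client so far. For a graph $G$ and $S\subseteq V(G)$, let $N_G(S)$ be the set of vertices in $V(G)\setminus S$ that have a neighbour in $S$. For real numbers $d'\ge 1$ and $0<\varepsilon<1$, a graph $G$ is a $(d',\varepsilon)$-expander if $|N_G(S)|\ge d'|S|$ for every $S\subseteq V(G)$ with $|S|\le \varepsilon|V(G)|$. Lemma. For every real number $d\ge 4$ there is an integer $N=N(d)$ such that for all integers $n\ge N$ and all integers $0\le q\le \frac{n}{1000d}$ the following holds. Playing the $(q:1)$ Waiter-Client game on $E(K_n)$, Waiter has a strategy which ensures, however Client plays, that after at most $200nd$ rounds Client's graph $G_C$ satisfies all of the following properties: (i) $G_C$ is a $\left(\frac d2-1,\frac1{20d}\right)$-expander; (ii) $G_C$ contains a cycle of length $k$ for every integer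 $3\le k\le\lceil n/6\rceil$; (iii) $G_C$ is connected. -/

import Mathlib

namespace WaiterClient

/-- The rounds played so far, most recent round first. A round is recorded as the pair consisting
of the set of elements offered by Waiter and the element of that set kept by Client. -/
abbrev History (α : Type*) : Type _ := List (Finset α × α)

section Game

variable {α : Type*} [DecidableEq α]

/-- All elements offered so far. Each of them has been claimed by one of the players: the element
kept by Client in a round belongs to Client, the others offered in that round to Waiter. -/
def offered (h : History α) : Finset α :=
  h.foldr (fun r s => r.1 ∪ s) ∅

/-- The elements claimed by Client so far. -/
def clientSet (h : History α) : Finset α :=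
  (h.map Prod.snd).toFinset

/-- The free (that is, unclaimed) elements of the board `X`. -/
def free (X : Finset α) (h : History α) : Finset α :=
  X \ offered h

/-- A strategy of Waiter in the `(q : 1)` game on the board `X`: whenever at least `q + 1` elements
are free, it offers exactly `q + 1` free elements. -/
structure WaiterStrategy (X : Finset α) (q : ℕ) where
  offer : History α → Finset α
  legal : ∀ h : History α, q + 1 ≤ (free X h).card →
    offer h ⊆ free X h ∧ (offer h).card = q + 1

/-- A strategy of Client: knowing the past and the set `A` offered in the current round, he keeps
an element of `A`. -/
structure ClientStrategy (α : Type*) where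
  pick : History α → Finset α → α
  legal : ∀ (h : History α) (A : Finset α), A.Nonempty → pick h A ∈ A

/-- The history after the first `t` rounds of the `(q : 1)` Waiter-Client game on the board `X`,
when Waiter plays by `σ` and Client by `τ`. When fewer than `q + 1` free elements remain, all of
them go to Waiter and the game is over, so that no further round is played. -/
def play {X : Finset α} {q : ℕ} (σ : WaiterStrategy X q) (τ : ClientStrategy α) : ℕ → History α
  | 0 => []
  | t + 1 =>
    if q + 1 ≤ (free X (play σ τ t)).card then
      (σ.offer (play σ τ t), τ.pick (play σ τ t) (σ.offer (play σ τ t))) :: play σ τ t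
    else play σ τ t

end Game

/-- The board of the game on the edge set of the complete graph with vertex set `Fin n`. -/
def edgeBoard (n : ℕ) : Finset (Sym2 (Fin n)) :=
  (⊤ : SimpleGraph (Fin n)).edgeFinset

/-- Client's graph after the first `t` rounds of the `(q : 1)` Waiter-Client game on the edge set
of the complete graph with vertex set `Fin n`: all vertices, and the edges claimed by Client. -/
def clientGraph {n q : ℕ} (σ : WaiterStrategy (edgeBoard n) q)
    (τ : ClientStrategy (Sym2 (Fin n))) (t : ℕ) : SimpleGraph (Fin n) :=
  SimpleGraph.fromEdgeSet (clientSet (play σ τ t) : Set (Sym2 (Fin n)))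

/-- The external neighbourhood `N_G(S)`: the vertices outside `S` with a neighbour in `S`. -/
def externalNeighbors {V : Type*} (G : SimpleGraph V) (S : Finset V) : Set V :=
  {v | v ∉ S ∧ ∃ u ∈ S, G.Adj u v}

/-- `G` is a `(d, ε)`-expander: `|N_G(S)| ≥ d |S|` for all `S ⊆ V(G)` with `|S| ≤ ε |V(G)|`. -/
def IsExpander {V : Type*} [Fintype V] (G : SimpleGraph V) (d ε : ℝ) : Prop :=
  ∀ S : Finset V, (S.card : ℝ) ≤ ε * (Fintype.card V : ℝ) →
    d * (S.card : ℝ) ≤ ((externalNeighbors G S).ncard : ℝ)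

/-- `G` contains a cycle of length `k`. -/
def HasCycleOfLength {V : Type*} (G : SimpleGraph V) (k : ℕ) : Prop :=
  ∃ (v : V) (c : G.Walk v v), c.IsCycle ∧ c.length = k

end WaiterClient

/-! Waiter fixes disjoint sets `W`, `Z`, `T₁`, `T₂`, `Y` and offers edges so that any answer of
Client helps.

Cycles. Client is led to a path `x 0, x 1, …` in `W` and to pendant edges from `x 0, …, x q` to
distinct `z 0, …, z q` in `Z`. For each `s`, Waiter then offers the `q + 1` edges from `z i` to `x
(i + s + 1)`: whichever is kept, a cycle of length `s + 3` is closed (`forces_chords`).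

Expansion. Each vertex `v` owns the edges to a large set `L v`, where `u ∈ L v` excludes `v ∈ L u`,
so no edge has two owners. Waiter plays `D` rounds at each vertex on its own edges. A set `S` that
fails to expand gives a small `U ⊇ S` containing every own neighbour that Client chose for a vertex
of `S`. A derandomised union bound rules this out: a potential, a weighted count of the pairs still
trapped, starts below `1` and can be kept from increasing (`exists_offer_potential_le`,
`sum_smallPairs_lt_one`).

Connectivity. Each vertex of `T₂` is joined directly to the path. Own edges lead from `T₁` to `T₂`,
and from vertices outside `T₁ ∪ T₂` to `T₁`, so every vertex reaches the path. -/

namespace WaiterClient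

open Finset

/-! ### Forcing positions in Waiter-Client games -/

section Forcing

variable {α : Type*} [DecidableEq α]

/-- From the position in which Client has claimed `C` and the elements of `O` have been offered,
Waiter can reach a position satisfying `P` within `k` rounds of the `(q : 1)` game on `X`. -/
def Forces (X : Finset α) (q : ℕ) (P : Finset α → Finset α → Prop) :
    ℕ → Finset α → Finset α → Prop
  | 0, C, O => P C O
  | k + 1, C, O => P C O ∨ ∃ A ⊆ X \ O, A.card = q + 1 ∧
      ∀ e ∈ A, Forces X q P k (insert e C) (A ∪ O)

variable {X : Finset α} {q : ℕ} {P Q : Finset α → Finset α → Prop}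

theorem Forces.of_pos {k : ℕ} {C O : Finset α} (h : P C O) : Forces X q P k C O := by
  cases k with
  | zero => exact h
  | succ k => exact Or.inl h

theorem Forces.mono {a b : ℕ} {C O : Finset α} (h : Forces X q P a C O) (hab : a ≤ b) :
    Forces X q P b C O := by
  induction a generalizing b C O with
  | zero => exact Forces.of_pos h
  | succ a ih =>
    obtain ⟨b, rfl⟩ : ∃ b', b = b' + 1 := ⟨b - 1, by omega⟩
    rcases h with h | ⟨A, hA, hc, h⟩
    · exact Or.inl h
    · exact Or.inr ⟨A, hA, hc, fun e he => ih (h e he) (by omega)⟩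

theorem Forces.trans {a b : ℕ} {C O : Finset α} (h : Forces X q P a C O)
    (hPQ : ∀ C' O', P C' O' → Forces X q Q b C' O') : Forces X q Q (a + b) C O := by
  induction a generalizing C O with
  | zero => exact (hPQ C O h).mono (by omega)
  | succ a ih =>
    rcases h with h | ⟨A, hA, hc, h⟩
    · exact (hPQ C O h).mono (by omega)
    · rw [Nat.add_right_comm]
      exact Or.inr ⟨A, hA, hc, fun e he => ih (h e he)⟩

theorem Forces.imp {a : ℕ} {C O : Finset α} (h : Forces X q P a C O)
    (hPQ : ∀ C' O', P C' O' → Q C' O') : Forces X q Q a C O :=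
  h.trans (b := 0) fun C' O' h' => hPQ C' O' h'

/-- Waiter can maintain an invariant for `N` rounds if it can do so in each single round. -/
theorem forces_of_invariant (I : ℕ → Finset α → Finset α → Prop) (N : ℕ)
    (hI : ∀ j < N, ∀ C O, I j C O →
      ∃ A ⊆ X \ O, A.card = q + 1 ∧ ∀ e ∈ A, I (j + 1) (insert e C) (A ∪ O))
    {C O : Finset α} (h : I 0 C O) : Forces X q (I N) N C O := by
  suffices H : ∀ k j, j + k = N → ∀ C O, I j C O → Forces X q (I N) k C O from
    H N 0 (by omega) C O h
  intro k
  induction k with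
  | zero =>
    rintro j rfl C O h
    exact h
  | succ k ih =>
    intro j hj C O h
    obtain ⟨A, hA, hc, hn⟩ := hI j (by omega) C O h
    exact Or.inr ⟨A, hA, hc, fun e he => ih (j + 1) (by omega) _ _ (hn e he)⟩

/-- A strategy sees only the history, not the number of rounds left. So Waiter always acts on the
least `r` for which the target is forced within `r` rounds, and a good offer lowers it. -/
theorem exists_strategy_of_forces {k : ℕ} (h : Forces X q P k ∅ ∅) :
    ∃ σ : WaiterStrategy X q, ∀ τ : ClientStrategy α, ∃ t ≤ k,
      P (clientSet (play σ τ t)) (offered (play σ τ t)) := by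
  classical
  -- The junk values `sInf ∅ = 0` and `0 - 1 = 0` are harmless: a good offer is used only when the
  -- infimum is attained and positive. Where none exists, any legal offer will do.
  let good : History α → Finset α → Prop := fun g A =>
    A ⊆ free X g ∧ A.card = q + 1 ∧
      ∀ e ∈ A, Forces X q P (sInf {r | Forces X q P r (clientSet g) (offered g)} - 1)
        (insert e (clientSet g)) (A ∪ offered g)
  have hleg : ∀ g : History α, ∃ A : Finset α, (q + 1 ≤ (free X g).card →
      A ⊆ free X g ∧ A.card = q + 1) ∧ ((∃ B, good g B) → good g A) := by
    intro g
    by_cases hg : ∃ B, good g B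
    · obtain ⟨B, hB⟩ := hg
      exact ⟨B, fun _ => ⟨hB.1, hB.2.1⟩, fun _ => hB⟩
    · by_cases hc : q + 1 ≤ (free X g).card
      · obtain ⟨A, hA⟩ := exists_subset_card_eq hc
        exact ⟨A, fun _ => hA, fun h => absurd h hg⟩
      · exact ⟨∅, fun h => absurd h hc, fun h => absurd h hg⟩
  choose f hf hf' using hleg
  refine ⟨⟨f, hf⟩, fun τ => ?_⟩
  set σ : WaiterStrategy X q := ⟨f, hf⟩
  suffices H : ∀ r t, Forces X q P r (clientSet (play σ τ t)) (offered (play σ τ t)) →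
      ∃ t' ≤ t + r, P (clientSet (play σ τ t')) (offered (play σ τ t')) by
    obtain ⟨t, ht, hP⟩ := H k 0 h
    exact ⟨t, by omega, hP⟩
  intro r
  induction r using Nat.strong_induction_on with
  | _ r ih =>
    intro t hr
    set g := play σ τ t with hg
    have hmem := Nat.sInf_mem (s := {r | Forces X q P r (clientSet g) (offered g)}) ⟨r, hr⟩
    have hle : sInf {r | Forces X q P r (clientSet g) (offered g)} ≤ r := Nat.sInf_le hr
    rcases hs : sInf {r | Forces X q P r (clientSet g) (offered g)} with _ | s
    · rw [hs] at hmem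
      exact ⟨t, by omega, hmem⟩
    · rw [hs] at hmem hle
      rcases hmem with hP | ⟨A, hA, hc, hn⟩
      · exact ⟨t, by omega, hP⟩
      · have hgood : good g (f g) := hf' g ⟨A, hA, hc, by rw [hs]; exact hn⟩
        obtain ⟨h1, h2, h3⟩ := hgood
        rw [hs] at h3
        have hcard : q + 1 ≤ (free X g).card := h2 ▸ card_le_card h1
        have hne : (f g).Nonempty := card_pos.1 (by omega)
        have hplay : play σ τ (t + 1) = (f g, τ.pick g (f g)) :: g := by
          simp only [play]
          rw [← hg, if_pos hcard]
        have := ih s (by omega) (t + 1) (by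
          rw [hplay]
          simpa [clientSet, offered] using h3 _ (τ.legal g (f g) hne))
        obtain ⟨t', ht', hP⟩ := this
        exact ⟨t', by omega, hP⟩

end Forcing

/-! ### Forcing the path, pendant edges, chords and attachments -/

section Edges

variable {n : ℕ} {q : ℕ}

theorem mk_mem_edgeBoard {a b : Fin n} : s(a, b) ∈ edgeBoard n ↔ a ≠ b := by
  simp [edgeBoard]

/-- A star of free edges is a legal offer. -/
theorem star_offer {O : Finset (Sym2 (Fin n))} {v : Fin n} {U : Finset (Fin n)} (hv : v ∉ U)
    (hU : U.card = q + 1) (hO : ∀ u ∈ U, s(v, u) ∉ O) :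
    U.image (fun u => s(v, u)) ⊆ edgeBoard n \ O ∧ (U.image (fun u => s(v, u))).card = q + 1 := by
  constructor
  · intro e he
    obtain ⟨u, hu, rfl⟩ := mem_image.1 he
    refine mem_sdiff.2 ⟨mk_mem_edgeBoard.2 ?_, hO u hu⟩
    rintro rfl
    exact hv hu
  · rw [card_image_of_injective _ fun a b h => Sym2.congr_right.1 h, hU]

/-- Waiter can force a path on `m` vertices inside any set of `m + q` vertices. -/
theorem forces_path {W : Finset (Fin n)} {m : ℕ} (hm : 0 < m) (hW : m + q ≤ W.card) :
    Forces (edgeBoard n) q (fun C O => ∃ x : ℕ → Fin n, Set.InjOn x (Set.Iio m) ∧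
      (∀ i < m, x i ∈ W) ∧ (∀ i, i + 1 < m → s(x i, x (i + 1)) ∈ C) ∧ O ⊆ W.sym2) m ∅ ∅ := by
  obtain ⟨w, hw⟩ : W.Nonempty := card_pos.1 (by omega)
  -- After `j` rounds the path ends at `x j`. The last clause says that every offered edge meets an
  -- earlier vertex, so the edges from `x j` to unvisited vertices are free.
  have := forces_of_invariant (X := edgeBoard n) (q := q) (fun j C O => ∃ x : ℕ → Fin n,
      Set.InjOn x (Set.Iio (j + 1)) ∧ (∀ i < j + 1, x i ∈ W) ∧
      (∀ i < j, s(x i, x (i + 1)) ∈ C) ∧ O ⊆ W.sym2 ∧ ∀ e ∈ O, ∃ i < j, x i ∈ e) (m - 1)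
    (C := ∅) (O := ∅) ?_ ⟨fun _ => w, ?_⟩
  · refine (this.imp ?_).mono (by omega)
    rintro C O ⟨x, h1, h2, h3, h4, -⟩
    rw [Nat.sub_add_cancel hm] at h1 h2
    exact ⟨x, h1, h2, fun i hi => h3 i (by omega), h4⟩
  · rintro j hj C O ⟨x, h1, h2, h3, h4, h5⟩
    have hcard : q + 1 ≤ (W \ (range (j + 1)).image x).card := by
      have := le_card_sdiff ((range (j + 1)).image x) W
      have h' : ((range (j + 1)).image x).card ≤ j + 1 := by
        simpa using card_image_le (s := range (j + 1)) (f := x)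
      omega
    obtain ⟨U, hU, hUc⟩ := exists_subset_card_eq hcard
    have hUx : ∀ u ∈ U, ∀ i < j + 1, x i ≠ u := fun u hu i hi h =>
      (mem_sdiff.1 (hU hu)).2 (mem_image.2 ⟨i, mem_range.2 hi, h⟩)
    have hfree : ∀ u ∈ U, s(x j, u) ∉ O := by
      intro u hu hO
      obtain ⟨i, hi, hmem⟩ := h5 _ hO
      rcases Sym2.mem_iff.1 hmem with h | h
      · have := h1 (by simp; omega) (by simp) h
        omega
      · exact hUx u hu i (by omega) h
    obtain ⟨hA, hAc⟩ := star_offer (fun h => hUx _ h j (by omega) rfl) hUc hfree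
    refine ⟨_, hA, hAc, fun e he => ?_⟩
    obtain ⟨u, hu, rfl⟩ := mem_image.1 he
    have hlt : ∀ i, i < j + 1 → Function.update x (j + 1) u i = x i := fun i hi =>
      Function.update_of_ne (by omega) _ _
    refine ⟨Function.update x (j + 1) u, ?_, ?_, ?_, ?_, ?_⟩
    · intro a ha b hb hab
      simp only [Set.mem_Iio] at ha hb
      rcases Nat.lt_succ_iff_lt_or_eq.1 ha with ha' | rfl <;>
      rcases Nat.lt_succ_iff_lt_or_eq.1 hb with hb' | rfl
      · rw [hlt a ha', hlt b hb'] at hab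
        exact h1 ha' hb' hab
      · rw [hlt a ha', Function.update_self] at hab
        exact absurd hab (hUx u hu a ha')
      · rw [hlt b hb', Function.update_self] at hab
        exact absurd hab.symm (hUx u hu b hb')
      · rfl
    · intro i hi
      rcases Nat.lt_succ_iff_lt_or_eq.1 hi with hi' | rfl
      · rw [hlt i hi']
        exact h2 i hi'
      · rw [Function.update_self]
        exact (mem_sdiff.1 (hU hu)).1
    · intro i hi
      rcases Nat.lt_succ_iff_lt_or_eq.1 hi with hi' | rfl
      · rw [hlt i (by omega), hlt (i + 1) (by omega)]
        exact mem_insert_of_mem (h3 i hi')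
      · rw [hlt i (by omega), Function.update_self]
        exact mem_insert_self _ _
    · refine union_subset (fun e he => ?_) h4
      obtain ⟨u', hu', rfl⟩ := mem_image.1 he
      exact mk_mem_sym2_iff.2 ⟨h2 j (by omega), (mem_sdiff.1 (hU hu')).1⟩
    · intro e he
      rcases mem_union.1 he with he | he
      · obtain ⟨u', hu', rfl⟩ := mem_image.1 he
        exact ⟨j, by omega, by rw [hlt j (by omega)]; simp⟩
      · obtain ⟨i, hi, hmem⟩ := h5 e he
        exact ⟨i, by omega, by rwa [hlt i (by omega)]⟩
  · refine ⟨?_, fun _ _ => hw, by simp, by simp, by simp⟩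
    intro a ha b hb _
    simp only [Set.mem_Iio] at ha hb
    omega

/-- Waiter can force a matching from the vertices `x 0, …, x q` into a set `Z` of `2q + 1`
vertices, leaving free the edges from the partner of `x i` to every `x l` with `i < l`. -/
theorem forces_pendants {W Z : Finset (Fin n)} (hWZ : Disjoint W Z) (hZ : 2 * q + 1 ≤ Z.card)
    {m : ℕ} {x : ℕ → Fin n} (hqm : q < m) (hx : Set.InjOn x (Set.Iio m)) (hxW : ∀ i < m, x i ∈ W)
    {C₀ O₀ : Finset (Sym2 (Fin n))} (hO₀ : O₀ ⊆ W.sym2) :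
    Forces (edgeBoard n) q (fun C O => ∃ z : ℕ → Fin n, C₀ ⊆ C ∧
      Set.InjOn z (Set.Iio (q + 1)) ∧ (∀ i < q + 1, z i ∈ Z) ∧
      (∀ i < q + 1, s(x i, z i) ∈ C) ∧ (∀ i < q + 1, ∀ l < m, i < l → s(x l, z i) ∉ O) ∧
      O ⊆ (W ∪ Z).sym2) (q + 1) C₀ O₀ := by
  have hne : ∀ w ∈ W, ∀ z ∈ Z, w ≠ z := fun w hw z hz h =>
    disjoint_left.1 hWZ hw (h ▸ hz)
  have hWZ' : W.sym2 ⊆ (W ∪ Z).sym2 := sym2_mono subset_union_left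
  have hO₀' : ∀ w, ∀ z ∈ Z, s(w, z) ∉ O₀ := fun w z hz h =>
    hne _ (mk_mem_sym2_iff.1 (hO₀ h)).2 z hz rfl
  by_cases hZe : Z.Nonempty
  swap
  · rw [not_nonempty_iff_eq_empty] at hZe
    subst hZe
    simp at hZ
  obtain ⟨z₀, hz₀⟩ := hZe
  -- Once `z i` is chosen it is never offered again, so only edges to `x l` with `l ≤ i` have been
  -- spent at it. This is what keeps the later chords free.
  refine (forces_of_invariant (X := edgeBoard n) (q := q) (fun j C O => ∃ z : ℕ → Fin n, C₀ ⊆ C ∧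
      Set.InjOn z (Set.Iio j) ∧ (∀ i < j, z i ∈ Z) ∧ (∀ i < j, s(x i, z i) ∈ C) ∧
      (∀ i < j, ∀ l < m, i < l → s(x l, z i) ∉ O) ∧ O ⊆ (W ∪ Z).sym2 ∧
      ∀ l < m, j ≤ l → ∀ z ∈ Z, s(x l, z) ∉ O) (q + 1) (C := C₀) (O := O₀) ?_
    ⟨fun _ => z₀, Subset.rfl, by simp, by simp, by simp, by simp, hO₀.trans hWZ',
      fun l _ _ z hz => hO₀' _ z hz⟩).imp ?_
  swap
  · rintro C O ⟨z, h1, h2, h3, h4, h5, h6, -⟩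
    exact ⟨z, h1, h2, h3, h4, h5, h6⟩
  rintro j hj C O ⟨z, h1, h2, h3, h4, h5, h6, h7⟩
  have hcard : q + 1 ≤ (Z \ (range j).image z).card := by
    have := le_card_sdiff ((range j).image z) Z
    have h' : ((range j).image z).card ≤ j := by
      simpa using card_image_le (s := range j) (f := z)
    omega
  obtain ⟨U, hU, hUc⟩ := exists_subset_card_eq hcard
  have hUZ : ∀ u ∈ U, u ∈ Z := fun u hu => (mem_sdiff.1 (hU hu)).1
  have hUz : ∀ u ∈ U, ∀ i < j, z i ≠ u := fun u hu i hi h =>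
    (mem_sdiff.1 (hU hu)).2 (mem_image.2 ⟨i, mem_range.2 hi, h⟩)
  have hjW : x j ∈ W := hxW j (by omega)
  obtain ⟨hA, hAc⟩ := star_offer (O := O) (v := x j) (fun h => hne _ hjW _ (hUZ _ h) rfl) hUc
    (fun u hu => h7 j (by omega) le_rfl u (hUZ u hu))
  have hnew : ∀ l < m, ∀ y ∈ Z, s(x l, y) ∈ U.image (fun u => s(x j, u)) → l = j ∧ y ∈ U := by
    intro l hl y hy h
    obtain ⟨u, hu, he⟩ := mem_image.1 h
    rcases Sym2.eq_iff.1 he with ⟨ha, rfl⟩ | ⟨ha, -⟩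
    · exact ⟨(hx (by simp; omega) (by simpa using hl) ha).symm, hu⟩
    · exact absurd ha (hne _ hjW _ hy)
  refine ⟨_, hA, hAc, fun e he => ?_⟩
  obtain ⟨u, hu, rfl⟩ := mem_image.1 he
  have hlt : ∀ i, i < j → Function.update z j u i = z i := fun i hi =>
    Function.update_of_ne (by omega) _ _
  refine ⟨Function.update z j u, h1.trans (subset_insert _ _), ?_, ?_, ?_, ?_, ?_, ?_⟩
  · intro a ha b hb hab
    simp only [Set.mem_Iio] at ha hb
    rcases Nat.lt_succ_iff_lt_or_eq.1 ha with ha' | rfl <;>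
    rcases Nat.lt_succ_iff_lt_or_eq.1 hb with hb' | rfl
    · rw [hlt a ha', hlt b hb'] at hab
      exact h2 ha' hb' hab
    · rw [hlt a ha', Function.update_self] at hab
      exact absurd hab (hUz u hu a ha')
    · rw [hlt b hb', Function.update_self] at hab
      exact absurd hab.symm (hUz u hu b hb')
    · rfl
  · intro i hi
    rcases Nat.lt_succ_iff_lt_or_eq.1 hi with hi' | rfl
    · rw [hlt i hi']
      exact h3 i hi'
    · rw [Function.update_self]
      exact hUZ u hu
  · intro i hi
    rcases Nat.lt_succ_iff_lt_or_eq.1 hi with hi' | rfl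
    · rw [hlt i hi']
      exact mem_insert_of_mem (h4 i hi')
    · rw [Function.update_self]
      exact mem_insert_self _ _
  · intro i hi l hl hil hmem
    rcases Nat.lt_succ_iff_lt_or_eq.1 hi with hi' | rfl
    · rw [hlt i hi'] at hmem
      rcases mem_union.1 hmem with hmem | hmem
      · exact hUz _ (hnew l hl _ (h3 i hi') hmem).2 i hi' rfl
      · exact h5 i hi' l hl hil hmem
    · rw [Function.update_self] at hmem
      rcases mem_union.1 hmem with hmem | hmem
      · have := (hnew l hl _ (hUZ u hu) hmem).1
        omega
      · exact h7 l hl (by omega) u (hUZ u hu) hmem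
  · refine union_subset (fun e he => ?_) h6
    obtain ⟨u', hu', rfl⟩ := mem_image.1 he
    exact mk_mem_sym2_iff.2 ⟨mem_union_left _ hjW, mem_union_right _ (hUZ u' hu')⟩
  · intro l hl hjl y hy hmem
    rcases mem_union.1 hmem with hmem | hmem
    · have := (hnew l hl y hy hmem).1
      omega
    · exact h7 l hl (by omega) y hy hmem

/-- Waiter can force, for each `s < N`, an edge joining some `z i` to `x (i + s + 1)`. -/
theorem forces_chords {W Z : Finset (Fin n)} (hWZ : Disjoint W Z) {m N : ℕ} {x z : ℕ → Fin n}
    (hm : q + N < m) (hx : Set.InjOn x (Set.Iio m)) (hxW : ∀ i < m, x i ∈ W)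
    (hz : Set.InjOn z (Set.Iio (q + 1))) (hzZ : ∀ i < q + 1, z i ∈ Z)
    {C₀ O₀ : Finset (Sym2 (Fin n))} (hO₀ : O₀ ⊆ (W ∪ Z).sym2)
    (hfree : ∀ i < q + 1, ∀ l < m, i < l → s(x l, z i) ∉ O₀) :
    Forces (edgeBoard n) q (fun C O => C₀ ⊆ C ∧
      (∀ s < N, ∃ i < q + 1, s(x (i + s + 1), z i) ∈ C) ∧ O ⊆ (W ∪ Z).sym2) N C₀ O₀ := by
  have hne : ∀ w ∈ W, ∀ z ∈ Z, w ≠ z := fun w hw z hz h =>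
    disjoint_left.1 hWZ hw (h ▸ hz)
  have hinj : ∀ i < q + 1, ∀ l < m, ∀ i' < q + 1, ∀ l' < m, s(x l, z i) = s(x l', z i') →
      l = l' ∧ i = i' := by
    intro i hi l hl i' hi' l' hl' h
    rcases Sym2.eq_iff.1 h with ⟨ha, hb⟩ | ⟨ha, -⟩
    · exact ⟨hx hl hl' ha, hz hi hi' hb⟩
    · exact absurd ha (hne _ (hxW l hl) _ (hzZ i' hi'))
  -- The offers for different `s` are disjoint, because an edge determines both indices and hence
  -- their difference.
  refine (forces_of_invariant (X := edgeBoard n) (q := q) (fun j C O => C₀ ⊆ C ∧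
      (∀ s < j, ∃ i < q + 1, s(x (i + s + 1), z i) ∈ C) ∧ O ⊆ (W ∪ Z).sym2 ∧
      ∀ s < N, j ≤ s → ∀ i < q + 1, s(x (i + s + 1), z i) ∉ O) N (C := C₀) (O := O₀) ?_
    ⟨Subset.rfl, by simp, hO₀, fun s hs _ i hi => hfree i hi _ (by omega) (by omega)⟩).imp
    fun C O h => ⟨h.1, h.2.1, h.2.2.1⟩
  rintro j hj C O ⟨h1, h2, h3, h4⟩
  refine ⟨(range (q + 1)).image fun i => s(x (i + j + 1), z i), ?_, ?_, ?_⟩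
  · intro e he
    obtain ⟨i, hi, rfl⟩ := mem_image.1 he
    rw [mem_range] at hi
    exact mem_sdiff.2 ⟨mk_mem_edgeBoard.2 (hne _ (hxW _ (by omega)) _ (hzZ i hi)),
      h4 j hj le_rfl i hi⟩
  · rw [card_image_of_injOn, card_range]
    intro a ha b hb hab
    simp only [coe_range, Set.mem_Iio] at ha hb
    exact (hinj a ha _ (by omega) b hb _ (by omega) hab).2
  · intro e he
    refine ⟨h1.trans (subset_insert _ _), ?_, ?_, ?_⟩
    · intro s hs
      rcases Nat.lt_succ_iff_lt_or_eq.1 hs with hs' | rfl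
      · obtain ⟨i, hi, hmem⟩ := h2 s hs'
        exact ⟨i, hi, mem_insert_of_mem hmem⟩
      · obtain ⟨i, hi, rfl⟩ := mem_image.1 he
        exact ⟨i, mem_range.1 hi, mem_insert_self _ _⟩
    · refine union_subset (fun e he => ?_) h3
      obtain ⟨i, hi, rfl⟩ := mem_image.1 he
      rw [mem_range] at hi
      exact mk_mem_sym2_iff.2 ⟨mem_union_left _ (hxW _ (by omega)), mem_union_right _ (hzZ i hi)⟩
    · intro s hs hjs i hi hmem
      rcases mem_union.1 hmem with hmem | hmem
      · obtain ⟨i', hi', he⟩ := mem_image.1 hmem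
        rw [mem_range] at hi'
        have := hinj i' hi' _ (by omega) i hi _ (by omega) he
        omega
      · exact h4 s hs (by omega) i hi hmem

/-- Waiter can force an edge from every vertex of `T` to a fixed set of `q + 1` vertices. -/
theorem forces_attach {B T : Finset (Fin n)} (hBT : Disjoint B T) (hB : B.card = q + 1)
    {C₀ O₀ : Finset (Sym2 (Fin n))} (hfree : ∀ v ∈ T, ∀ b ∈ B, s(v, b) ∉ O₀) :
    Forces (edgeBoard n) q (fun C O => C₀ ⊆ C ∧ (∀ v ∈ T, ∃ b ∈ B, s(v, b) ∈ C) ∧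
      ∀ e ∈ O, e ∈ O₀ ∨ ∃ v ∈ T, ∃ b ∈ B, e = s(v, b)) T.card C₀ O₀ := by
  have hne : ∀ b ∈ B, ∀ v ∈ T, b ≠ v := fun w hw z hz h =>
    disjoint_left.1 hBT hw (h ▸ hz)
  refine (forces_of_invariant (X := edgeBoard n) (q := q) (fun j C O => C₀ ⊆ C ∧
      ∃ R ⊆ T, R.card = j ∧ (∀ v ∈ R, ∃ b ∈ B, s(v, b) ∈ C) ∧
      ∀ e ∈ O, e ∈ O₀ ∨ ∃ v ∈ R, ∃ b ∈ B, e = s(v, b)) T.card (C := C₀) (O := O₀) ?_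
    ⟨Subset.rfl, ∅, by simp, by simp, by simp, fun e he => Or.inl he⟩).imp ?_
  swap
  · rintro C O ⟨h1, R, hR, hRc, h2, h3⟩
    obtain rfl := eq_of_subset_of_card_le hR hRc.ge
    exact ⟨h1, h2, h3⟩
  rintro j hj C O ⟨h1, R, hR, rfl, h2, h3⟩
  obtain ⟨v, hv, hvR⟩ := exists_of_ssubset (ssubset_of_subset_of_ne hR (by rintro rfl; omega))
  have hfr : ∀ b ∈ B, s(v, b) ∉ O := by
    intro b hb hO
    rcases h3 _ hO with h | ⟨v', hv', b', hb', h⟩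
    · exact hfree v hv b hb h
    · rcases Sym2.eq_iff.1 h with ⟨rfl, -⟩ | ⟨ha, -⟩
      · exact hvR hv'
      · exact hne b' hb' v hv ha.symm
  obtain ⟨hA, hAc⟩ := star_offer (fun h => hne v h v hv rfl) hB hfr
  refine ⟨_, hA, hAc, fun e he => ⟨h1.trans (subset_insert _ _), insert v R,
    insert_subset hv hR, card_insert_of_notMem hvR, ?_, ?_⟩⟩
  · intro y hy
    rcases mem_insert.1 hy with rfl | hy
    · obtain ⟨b, hb, rfl⟩ := mem_image.1 he
      exact ⟨b, hb, mem_insert_self _ _⟩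
    · obtain ⟨b, hb, h⟩ := h2 y hy
      exact ⟨b, hb, mem_insert_of_mem h⟩
  · intro e he
    rcases mem_union.1 he with he | he
    · obtain ⟨b, hb, rfl⟩ := mem_image.1 he
      exact Or.inr ⟨v, mem_insert_self _ _, b, hb, rfl⟩
    · rcases h3 e he with h | ⟨y, hy, b, hb, h⟩
      · exact Or.inl h
      · exact Or.inr ⟨y, mem_insert_of_mem hy, b, hb, h⟩

end Edges

/-! ### The potential argument for escaping traps -/

section Potential

variable {n q : ℕ}

/-- A pair `(S, U)` is trapped if every edge of Client leading from some `v ∈ S` into `L v` ends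
in `U`. -/
def Trapped (L : Fin n → Finset (Fin n)) (C : Finset (Sym2 (Fin n)))
    (p : Finset (Fin n) × Finset (Fin n)) : Prop :=
  ∀ v ∈ p.1, ∀ u ∈ L v, s(v, u) ∈ C → u ∈ p.2

/-- Asymmetry of `L` makes the new edge an own edge of `v` only, so it imposes no condition at `u`.
-/
theorem trapped_insert {L : Fin n → Finset (Fin n)} (hL : ∀ v, ∀ u ∈ L v, v ∉ L u)
    {C : Finset (Sym2 (Fin n))} {v u : Fin n} (hu : u ∈ L v)
    (p : Finset (Fin n) × Finset (Fin n)) :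
    Trapped L (insert s(v, u) C) p ↔ Trapped L C p ∧ (v ∈ p.1 → u ∈ p.2) := by
  constructor
  · intro h
    exact ⟨fun a ha b hb hab => h a ha b hb (mem_insert_of_mem hab),
      fun hv => h v hv u hu (mem_insert_self _ _)⟩
  · rintro ⟨h, h'⟩ a ha b hb hab
    rcases mem_insert.1 hab with hab | hab
    · rcases Sym2.eq_iff.1 hab with ⟨rfl, rfl⟩ | ⟨rfl, rfl⟩
      · exact h' ha
      · exact absurd hb (hL _ _ hu)
    · exact h a ha b hb hab

/-- Markov's inequality: many elements of `F` have a value at most `b`. -/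
theorem exists_subset_le_of_sum_le {α : Type*} {F : Finset α} {g : α → ℝ} {b : ℝ} {M q : ℕ}
    (hM : 0 < M) (hg : ∀ u ∈ F, 0 ≤ g u) (hsum : ∑ u ∈ F, g u ≤ M * b)
    (hF : M + q ≤ F.card) : ∃ A ⊆ F, A.card = q + 1 ∧ ∀ u ∈ A, g u ≤ b := by
  classical
  have hlt : (F.filter fun u => b < g u).card < M := by
    by_contra! hle
    have hpos : 0 < (F.filter fun u => b < g u).card := by omega
    have h1 : ∑ _u ∈ F.filter (fun u => b < g u), b < ∑ u ∈ F.filter (fun u => b < g u), g u :=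
      sum_lt_sum_of_nonempty (card_pos.1 hpos) fun u hu => (mem_filter.1 hu).2
    have h2 : ∑ u ∈ F.filter (fun u => b < g u), g u ≤ ∑ u ∈ F, g u :=
      sum_le_sum_of_subset_of_nonneg (filter_subset _ _) fun u hu _ => hg u hu
    rw [sum_const, nsmul_eq_mul] at h1
    have hb : 0 ≤ b := by
      have h0 : (0 : ℝ) ≤ M * b := (sum_nonneg hg).trans hsum
      exact nonneg_of_mul_nonneg_right h0 (by exact_mod_cast hM)
    have h3 : (M : ℝ) * b ≤ (F.filter fun u => b < g u).card * b :=
      mul_le_mul_of_nonneg_right (by exact_mod_cast hle) hb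
    linarith
  have hcard := card_filter_add_card_filter_not (s := F) (fun u => b < g u)
  obtain ⟨A, hA, hAc⟩ := exists_subset_card_eq
    (show q + 1 ≤ (F.filter fun u => ¬ b < g u).card by omega)
  exact ⟨A, hA.trans (filter_subset _ _), hAc, fun u hu => not_lt.1 (mem_filter.1 (hA hu)).2⟩

open Classical in
/-- The potential of a position, when Waiter is going to play one round at each entry of `l`. -/
noncomputable def potential (L : Fin n → Finset (Fin n))
    (B : Finset (Finset (Fin n) × Finset (Fin n))) (M : ℕ) (l : List (Fin n))
    (C : Finset (Sym2 (Fin n))) : ℝ :=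
  ∑ p ∈ B with Trapped L C p, ((p.2.card : ℝ) / M) ^ l.countP (· ∈ p.1)

open Classical in
/-- Among sufficiently many neighbours in `L v` Waiter finds `q + 1` of them none of which
increases the potential. -/
theorem exists_offer_potential_le {L : Fin n → Finset (Fin n)}
    (hL : ∀ v, ∀ u ∈ L v, v ∉ L u) (B : Finset (Finset (Fin n) × Finset (Fin n))) {M : ℕ}
    (hM : 0 < M) (v : Fin n) (l : List (Fin n)) (C : Finset (Sym2 (Fin n)))
    {F : Finset (Fin n)} (hFL : F ⊆ L v) (hF : M + q ≤ F.card) :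
    ∃ A ⊆ F, A.card = q + 1 ∧
      ∀ u ∈ A, potential L B M l (insert s(v, u) C) ≤ potential L B M (v :: l) C := by
  set w : Finset (Fin n) × Finset (Fin n) → ℝ := fun p =>
    ((p.2.card : ℝ) / M) ^ l.countP (· ∈ p.1) with hw
  have hw0 : ∀ p, 0 ≤ w p := fun p => by positivity
  set T := B.filter (Trapped L C) with hT
  set g : Fin n → ℝ := fun u => ∑ p ∈ T with v ∈ p.1 ∧ u ∈ p.2, w p with hg
  set b : ℝ := ∑ p ∈ T with v ∈ p.1, (p.2.card : ℝ) / M * w p with hb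
  have hsum : ∑ u ∈ F, g u ≤ M * b := by
    have h3 : ∀ p : Finset (Fin n) × Finset (Fin n),
        ∑ u ∈ F, (if u ∈ p.2 then w p else 0) ≤ p.2.card * w p := by
      intro p
      rw [← sum_filter, sum_const, nsmul_eq_mul]
      refine mul_le_mul_of_nonneg_right ?_ (hw0 p)
      exact_mod_cast card_le_card fun u hu => (mem_filter.1 hu).2
    calc ∑ u ∈ F, g u = ∑ u ∈ F, ∑ p ∈ T with v ∈ p.1, if u ∈ p.2 then w p else 0 := by
          refine sum_congr rfl fun u _ => ?_
          simp only [hg]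
          rw [← filter_filter, sum_filter]
      _ = ∑ p ∈ T with v ∈ p.1, ∑ u ∈ F, if u ∈ p.2 then w p else 0 := sum_comm
      _ ≤ ∑ p ∈ T with v ∈ p.1, (p.2.card : ℝ) * w p := sum_le_sum fun p _ => h3 p
      _ = M * b := by
          rw [hb, mul_sum]
          refine sum_congr rfl fun p _ => ?_
          have : (M : ℝ) ≠ 0 := by positivity
          field_simp
  obtain ⟨A, hA, hAc, hle⟩ := exists_subset_le_of_sum_le (F := F) (g := g) (b := b) hM
    (fun u _ => sum_nonneg fun p _ => hw0 p) hsum hF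
  refine ⟨A, hA, hAc, fun u hu => ?_⟩
  -- Pairs with `v ∉ p.1` contribute the same before and after. The others contributed `b` and now
  -- contribute `g u`, since only those with `u ∈ p.2` stay trapped.
  have h1 : potential L B M l (insert s(v, u) C) = (∑ p ∈ T with v ∉ p.1, w p) + g u := by
    have : (B.filter fun p => Trapped L (insert s(v, u) C) p) =
        T.filter (fun p => v ∉ p.1) ∪ T.filter (fun p => v ∈ p.1 ∧ u ∈ p.2) := by
      ext p
      simp only [mem_filter, mem_union, hT, trapped_insert hL (hFL (hA hu))]
      tauto
    rw [potential, this, sum_union]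
    rw [disjoint_filter]
    tauto
  have h2 : potential L B M (v :: l) C = (∑ p ∈ T with v ∉ p.1, w p) + b := by
    rw [potential, ← sum_filter_add_sum_filter_not T (fun p => v ∉ p.1)]
    congr 1
    · refine sum_congr rfl fun p hp => ?_
      simp [hw, (mem_filter.1 hp).2]
    · simp only [not_not]
      refine sum_congr rfl fun p hp => ?_
      simp [hw, (mem_filter.1 hp).2, pow_succ']
  rw [h1, h2]
  linarith [hle u hu]

/-- If the initial potential is less than `1`, then by playing one round at each entry of `l`
Waiter ensures that no pair remains trapped. -/
theorem forces_not_trapped {L : Fin n → Finset (Fin n)} (hL : ∀ v, ∀ u ∈ L v, v ∉ L u)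
    (B : Finset (Finset (Fin n) × Finset (Fin n))) {M : ℕ} (hM : 0 < M) (l : List (Fin n))
    {C O : Finset (Sym2 (Fin n))}
    (havail : ∀ v, M + l.count v * (q + 1) ≤ ((L v).filter fun u => s(v, u) ∉ O).card)
    (hpot : potential L B M l C < 1) :
    Forces (edgeBoard n) q (fun C' _ => C ⊆ C' ∧ ∀ p ∈ B, ¬ Trapped L C' p) l.length C O := by
  induction l generalizing C O with
  | nil =>
    refine ⟨Subset.rfl, fun p hp htr => ?_⟩
    classical
    simp only [potential, List.countP_nil, pow_zero, sum_const, nsmul_eq_mul, mul_one] at hpot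
    have : (B.filter (Trapped L C)).card = 0 := by
      have : (B.filter (Trapped L C)).card < 1 := by
        convert (by exact_mod_cast hpot : (B.filter (Trapped L C)).card < 1)
      omega
    exact absurd (mem_filter.2 ⟨hp, htr⟩) (by rw [card_eq_zero.1 this]; simp)
  | cons v l ih =>
    have hv := havail v
    rw [List.count_cons_self, add_mul, one_mul] at hv
    obtain ⟨A, hA, hAc, hle⟩ := exists_offer_potential_le (q := q) hL B hM v l C
      (filter_subset (fun u => s(v, u) ∉ O) (L v)) (by omega)
    have hAL : ∀ u ∈ A, u ∈ L v := fun u hu => (mem_filter.1 (hA hu)).1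
    obtain ⟨hX, hXc⟩ := star_offer (fun h => hL v v (hAL v h) (hAL v h)) hAc
      (fun u hu => (mem_filter.1 (hA hu)).2)
    refine Or.inr ⟨_, hX, hXc, fun e he => ?_⟩
    obtain ⟨u, hu, rfl⟩ := mem_image.1 he
    refine (ih (C := insert s(v, u) C) ?_ ((hle u hu).trans_lt hpot)).imp
      fun C' _ h => ⟨(subset_insert _ _).trans h.1, h.2⟩
    intro y
    by_cases hyv : y = v
    · subst hyv
      have hsub : ((L y).filter fun u => s(y, u) ∉ O) \ A ⊆
          (L y).filter fun u => s(y, u) ∉ A.image (fun u => s(y, u)) ∪ O := by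
        intro a ha
        obtain ⟨ha, haA⟩ := mem_sdiff.1 ha
        refine mem_filter.2 ⟨(mem_filter.1 ha).1, fun h => ?_⟩
        rcases mem_union.1 h with h | h
        · obtain ⟨a', ha', h⟩ := mem_image.1 h
          exact haA (Sym2.congr_right.1 h ▸ ha')
        · exact (mem_filter.1 ha).2 h
      have h1 := card_le_card hsub
      rw [card_sdiff_of_subset hA] at h1
      omega
    -- By asymmetry, the edges offered at `v` are not own edges of `y`, so the supply at `y` is
    -- untouched.
    · have hy := havail y
      rw [List.count_cons_of_ne (Ne.symm hyv)] at hy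
      refine hy.trans (card_le_card fun a ha => ?_)
      refine mem_filter.2 ⟨(mem_filter.1 ha).1, fun h => ?_⟩
      rcases mem_union.1 h with h | h
      · obtain ⟨a', ha', h⟩ := mem_image.1 h
        rcases Sym2.eq_iff.1 h with ⟨h1, -⟩ | ⟨rfl, rfl⟩
        · exact hyv h1.symm
        · exact hL _ _ (hAL _ ha') (mem_filter.1 ha).1
      · exact (mem_filter.1 ha).2 h

/-! ### Bounding the initial potential -/

/-- The pairs `S ⊆ U` with `U` small but not much larger than `S`. -/
noncomputable def smallPairs (n : ℕ) (d : ℝ) : Finset (Finset (Fin n) × Finset (Fin n)) :=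
  open Classical in
  univ.filter fun p => p.1 ⊆ p.2 ∧ p.1.Nonempty ∧ (p.2.card : ℝ) ≤ d / 2 * p.1.card ∧
    40 * p.2.card ≤ n

theorem mem_smallPairs {d : ℝ} {p : Finset (Fin n) × Finset (Fin n)} :
    p ∈ smallPairs n d ↔ p.1 ⊆ p.2 ∧ p.1.Nonempty ∧ (p.2.card : ℝ) ≤ d / 2 * p.1.card ∧
      40 * p.2.card ≤ n := by
  simp [smallPairs]

/-- Of the ten factors `(u / M) ^ u`, one absorbs `n ^ u`, leaving `(5 * u) ^ u / u! ≤ 15 ^ u`. The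
other nine are at most `(1 / 8) ^ u` each. -/
theorem choose_mul_pow_le {M u : ℕ} (hM : 0 < M) (hn : n ≤ 5 * M) (hu : 40 * u ≤ n) :
    (n.choose u : ℝ) * (2 ^ u * ((u : ℝ) / M) ^ (10 * u)) ≤ (1 / 4) ^ u := by
  have hM' : (0 : ℝ) < M := by exact_mod_cast hM
  have hn' : (n : ℝ) ≤ 5 * M := by exact_mod_cast hn
  have hu' : (40 : ℝ) * u ≤ n := by exact_mod_cast hu
  have h1 : (n.choose u : ℝ) ≤ n ^ u / u.factorial := Nat.choose_le_pow_div u n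
  have h2 : (u : ℝ) / M ≤ 1 / 8 := by
    rw [div_le_iff₀ hM']
    linarith
  have h3 : (n : ℝ) * (u / M) ≤ 5 * u := by
    rw [← mul_div_assoc, div_le_iff₀ hM']
    nlinarith [Nat.cast_nonneg (α := ℝ) u]
  have h4 : (u : ℝ) ^ u / u.factorial ≤ 3 ^ u := by
    calc (u : ℝ) ^ u / u.factorial ≤ Real.exp u := Real.pow_div_factorial_le_exp _ (by positivity) u
      _ = Real.exp 1 ^ u := by rw [← Real.exp_nat_mul, mul_one]
      _ ≤ 3 ^ u := pow_le_pow_left₀ (Real.exp_pos 1).le Real.exp_one_lt_three.le u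
  calc (n.choose u : ℝ) * (2 ^ u * ((u : ℝ) / M) ^ (10 * u))
      ≤ n ^ u / u.factorial * (2 ^ u * ((u : ℝ) / M) ^ (10 * u)) := by gcongr
    _ = (n * (u / M)) ^ u / u.factorial * (2 ^ u * (((u : ℝ) / M) ^ 9) ^ u) := by
        rw [mul_pow (n : ℝ), show 10 * u = u + 9 * u by ring, pow_add, pow_mul]
        ring
    _ ≤ (5 * u) ^ u / u.factorial * (2 ^ u * ((1 / 8) ^ 9) ^ u) := by gcongr
    _ = (u ^ u / u.factorial) * (5 * 2 * (1 / 8) ^ 9) ^ u := by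
        rw [mul_pow, mul_pow, mul_pow]
        ring
    _ ≤ 3 ^ u * (5 * 2 * (1 / 8) ^ 9) ^ u := by gcongr
    _ = (3 * (5 * 2 * (1 / 8) ^ 9)) ^ u := (mul_pow _ _ _).symm
    _ ≤ (1 / 4) ^ u := by
        gcongr
        norm_num

/-- Since `D * |S| ≥ 5 * d * |S| ≥ 10 * |U|`, each term is at most `(|U| / M) ^ (10 * |U|)`. Summing
over the `2 ^ |U|` subsets of each `U` and then by size gives a geometric series of sum `1 / 3`. -/
theorem sum_smallPairs_lt_one {d : ℝ} {M D : ℕ} (hM : 0 < M) (hn : n ≤ 5 * M)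
    (hD : 5 * d ≤ D) :
    ∑ p ∈ smallPairs n d, ((p.2.card : ℝ) / M) ^ (D * p.1.card) < 1 := by
  classical
  -- The cutoff keeps the size bound when the sum is enlarged to all pairs `S ⊆ U`, and discards `u
  -- = 0`, where the power would be `1`.
  set g : ℕ → ℝ := fun u => if 0 < u ∧ 40 * u ≤ n then ((u : ℝ) / M) ^ (10 * u) else 0 with hg
  have hg0 : ∀ u, 0 ≤ g u := fun u => by
    simp only [hg]
    split_ifs <;> positivity
  have h1 : ∀ p ∈ smallPairs n d,
      ((p.2.card : ℝ) / M) ^ (D * p.1.card) ≤ g p.2.card := by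
    intro p hp
    obtain ⟨h1, h2, h3, h4⟩ := mem_smallPairs.1 hp
    have hpos : 0 < p.2.card := (card_pos.2 h2).trans_le (card_le_card h1)
    simp only [hg]
    rw [if_pos ⟨hpos, h4⟩]
    have hM' : (0 : ℝ) < M := by exact_mod_cast hM
    refine pow_le_pow_of_le_one (by positivity) ?_ ?_
    · rw [div_le_one hM']
      exact_mod_cast (by omega : p.2.card ≤ M)
    · have : (10 * p.2.card : ℝ) ≤ D * p.1.card := by
        nlinarith [Nat.cast_nonneg (α := ℝ) p.1.card]
      exact_mod_cast this
  have h2 : ∑ p ∈ smallPairs n d, g p.2.card ≤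
      ∑ U ∈ (univ : Finset (Fin n)).powerset, 2 ^ U.card * g U.card := by
    calc ∑ p ∈ smallPairs n d, g p.2.card
        ≤ ∑ p ∈ (univ : Finset (Finset (Fin n) × Finset (Fin n))) with p.1 ⊆ p.2, g p.2.card :=
          sum_le_sum_of_subset_of_nonneg
            (fun p hp => mem_filter.2 ⟨mem_univ _, (mem_smallPairs.1 hp).1⟩) fun p _ _ => hg0 _
      _ = ∑ U : Finset (Fin n), ∑ S : Finset (Fin n), if S ⊆ U then g U.card else 0 := by
          rw [sum_filter, ← univ_product_univ, sum_product_right]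
      _ = _ := by
          rw [powerset_univ]
          refine sum_congr rfl fun U _ => ?_
          rw [← sum_filter, sum_const, nsmul_eq_mul,
            show (univ.filter fun S => S ⊆ U) = U.powerset by ext; simp, card_powerset]
          push_cast
          rfl
  rw [sum_powerset_apply_card (fun u => 2 ^ u * g u), card_univ, Fintype.card_fin,
    sum_range_succ'] at h2
  have h3 : ∀ u, (n.choose (u + 1)) • ((2 : ℝ) ^ (u + 1) * g (u + 1)) ≤ (1 / 4) ^ (u + 1) := by
    intro u
    rw [nsmul_eq_mul]
    simp only [hg]
    split_ifs with h
    · exact choose_mul_pow_le hM hn h.2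
    · simp only [mul_zero]
      positivity
  have h4 : ∀ k : ℕ, ∑ u ∈ range k, ((1 : ℝ) / 4) ^ (u + 1) ≤ 1 / 3 - (1 / 4) ^ k / 3 := by
    intro k
    induction k with
    | zero => simp
    | succ k ih =>
      rw [sum_range_succ, pow_succ (1 / 4 : ℝ) k]
      linarith
  have h5 : n.choose 0 • ((2 : ℝ) ^ 0 * g 0) = 0 := by simp [hg]
  have h6 := sum_le_sum fun u (_ : u ∈ range n) => h3 u
  have h7 : (0 : ℝ) < (1 / 4) ^ n := by positivity
  linarith [sum_le_sum h1, h4 n]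

/-- Waiter can make Client escape from all pairs of `smallPairs n d` by playing `D` rounds at each
vertex. -/
theorem forces_escape {L : Fin n → Finset (Fin n)} (hL : ∀ v, ∀ u ∈ L v, v ∉ L u) {d : ℝ}
    {M D : ℕ} (hM : 0 < M) (hn : n ≤ 5 * M) (hD : 5 * d ≤ D)
    {C O : Finset (Sym2 (Fin n))} (hO : ∀ v, ∀ u ∈ L v, s(v, u) ∉ O)
    (hLc : ∀ v, M + D * (q + 1) ≤ (L v).card) :
    Forces (edgeBoard n) q (fun C' _ => C ⊆ C' ∧ ∀ p ∈ smallPairs n d, ¬ Trapped L C' p)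
      (D * n) C O := by
  -- Each vertex occurs `D` times; the order is immaterial because only the counts matter.
  set l : List (Fin n) := (D • (univ : Finset (Fin n)).val).toList with hl
  have hlen : l.length = D * n := by simp [hl]
  have hcount : ∀ v, l.count v = D := fun v => by
    rw [← Multiset.coe_count, hl, Multiset.coe_toList, Multiset.count_nsmul,
      Multiset.count_eq_one_of_mem univ.nodup (mem_univ v), mul_one]
  have hcountP : ∀ S : Finset (Fin n), l.countP (· ∈ S) = D * S.card := fun S => by
    rw [← Multiset.coe_countP, hl, Multiset.coe_toList, Multiset.countP_nsmul,
      Multiset.countP_eq_card_filter, ← filter_val, card_val]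
    simp
  classical
  rw [← hlen]
  refine forces_not_trapped hL _ hM l (fun v => ?_) ?_
  · rw [hcount, filter_true_of_mem (hO v)]
    exact hLc v
  · refine lt_of_le_of_lt ?_ (sum_smallPairs_lt_one (n := n) hM hn hD)
    simp only [potential, hcountP]
    exact sum_le_sum_of_subset_of_nonneg (filter_subset _ _) fun p _ _ => by positivity

end Potential

/-! ### From Client's edges to cycles, expansion and connectivity -/

section Graph

variable {V : Type*} {G : SimpleGraph V}

theorem exists_isPath_of_injOn {m : ℕ} {x : ℕ → V} (hx : Set.InjOn x (Set.Iio m))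
    (hadj : ∀ i, i + 1 < m → G.Adj (x i) (x (i + 1))) (l a : ℕ) (h : a + l < m) :
    ∃ p : G.Walk (x a) (x (a + l)), p.IsPath ∧ p.length = l ∧
      ∀ v ∈ p.support, ∃ j, a ≤ j ∧ j < m ∧ v = x j := by
  induction l generalizing a with
  | zero =>
    refine ⟨SimpleGraph.Walk.nil, by simp, by simp, fun v hv => ⟨a, le_rfl, by omega, ?_⟩⟩
    simpa using hv
  | succ l ih =>
    obtain ⟨p, hp, hl, hs⟩ := ih (a + 1) (by omega)
    rw [show a + (l + 1) = a + 1 + l by ring]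
    refine ⟨SimpleGraph.Walk.cons (hadj a (by omega)) p, ?_, by simp [hl], ?_⟩
    -- The lower bound on the indices in the support keeps `x a` off the path starting at `x (a +
    -- 1)`.
    · refine (SimpleGraph.Walk.cons_isPath_iff _ _).2 ⟨hp, fun hmem => ?_⟩
      obtain ⟨j, hj, hjm, h'⟩ := hs _ hmem
      have := hx (Set.mem_Iio.2 (by omega)) (Set.mem_Iio.2 hjm) h'
      omega
    · intro v hv
      rw [SimpleGraph.Walk.support_cons, List.mem_cons] at hv
      rcases hv with rfl | hv
      · exact ⟨a, le_rfl, by omega, rfl⟩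
      · obtain ⟨j, hj, hjm, h'⟩ := hs _ hv
        exact ⟨j, by omega, hjm, h'⟩

/-- A vertex off a path and adjacent to two vertices of the path closes a cycle. -/
theorem hasCycleOfLength_of_path {m : ℕ} {x : ℕ → V} (hx : Set.InjOn x (Set.Iio m))
    (hadj : ∀ i, i + 1 < m → G.Adj (x i) (x (i + 1))) {z : V} (hz : ∀ i < m, x i ≠ z) {i s : ℕ}
    (h : i + s + 1 < m) (h1 : G.Adj (x i) z) (h2 : G.Adj (x (i + s + 1)) z) :
    HasCycleOfLength G (s + 3) := by
  obtain ⟨p, hp, hl, hs⟩ := exists_isPath_of_injOn hx hadj (s + 1) i (by omega)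
  have hzp : z ∉ p.support := fun hmem => by
    obtain ⟨j, -, hjm, h'⟩ := hs _ hmem
    exact hz j hjm h'.symm
  refine ⟨_, SimpleGraph.Walk.cons h2 (SimpleGraph.Walk.cons h1.symm p), ?_, by simp [hl]⟩
  rw [SimpleGraph.Walk.cons_isCycle_iff, SimpleGraph.Walk.cons_isPath_iff]
  refine ⟨⟨hp, hzp⟩, fun hmem => ?_⟩
  rw [SimpleGraph.Walk.edges_cons, List.mem_cons] at hmem
  rcases hmem with hmem | hmem
  · rcases Sym2.eq_iff.1 hmem with ⟨h', -⟩ | ⟨h', -⟩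
    · exact hz _ h h'
    · have := hx (Set.mem_Iio.2 h) (Set.mem_Iio.2 (by omega)) h'
      omega
  · exact hzp (SimpleGraph.Walk.snd_mem_support_of_mem_edges _ hmem)

end Graph

variable {n q : ℕ}

/-- The graph formed by Client's edges. -/
abbrev graphOf (C : Finset (Sym2 (Fin n))) : SimpleGraph (Fin n) :=
  SimpleGraph.fromEdgeSet (C : Set (Sym2 (Fin n)))

theorem graphOf_adj {C : Finset (Sym2 (Fin n))} {a b : Fin n} (h : s(a, b) ∈ C) (hne : a ≠ b) :
    (graphOf C).Adj a b :=
  (SimpleGraph.fromEdgeSet_adj _).2 ⟨by exact_mod_cast h, hne⟩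

/-- If `S` violates expansion, then `S` with its external neighbourhood `N` is a trapped pair `(S, S
∪ N)`; `|S| ≤ n / (20 * d)` makes `|S ∪ N| ≤ n / 40`. -/
theorem isExpander_of_not_trapped {L : Fin n → Finset (Fin n)} {d : ℝ} (hd : 0 < d) {C : Finset (Sym2 (Fin n))}
    (h : ∀ p ∈ smallPairs n d, ¬ Trapped L C p) :
    IsExpander (graphOf C) (d / 2 - 1) (1 / (20 * d)) := by
  classical
  intro S hS
  by_contra! hlt
  set N := (Set.toFinite (externalNeighbors (graphOf C) S)).toFinset with hN
  have hNc : (externalNeighbors (graphOf C) S).ncard = N.card :=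
    Set.ncard_eq_toFinset_card _ _
  rw [hNc] at hlt
  rw [Fintype.card_fin] at hS
  have hSne : S.Nonempty := by
    rw [nonempty_iff_ne_empty]
    rintro rfl
    simp only [card_empty, Nat.cast_zero, mul_zero] at hlt
    exact absurd hlt (not_lt.2 (Nat.cast_nonneg _))
  have hU : ((S ∪ N).card : ℝ) ≤ d / 2 * S.card := by
    have : ((S ∪ N).card : ℝ) ≤ S.card + N.card := by exact_mod_cast card_union_le S N
    linarith
  have hU' : (40 : ℝ) * (S ∪ N).card ≤ n := by
    have h1 : (20 * d) * (S.card : ℝ) ≤ n := by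
      calc (20 * d) * (S.card : ℝ) ≤ (20 * d) * (1 / (20 * d) * n) := by gcongr
        _ = n := by field_simp
    linarith
  refine h (S, S ∪ N) (mem_smallPairs.2
    ⟨subset_union_left, hSne, hU, by exact_mod_cast hU'⟩) fun v hv u hu hvu => ?_
  by_cases huS : u ∈ S
  · exact mem_union_left _ huS
  · refine mem_union_right _ ((Set.Finite.mem_toFinset _).2 ⟨huS, v, hv, graphOf_adj hvu ?_⟩)
    rintro rfl
    exact huS hv

/-- Without such an edge the pair `({v}, {v})` would be vacuously trapped. -/
theorem exists_edge_of_not_trapped {L : Fin n → Finset (Fin n)} {d : ℝ} (hd : 2 ≤ d)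
    (hn : 40 ≤ n) {C : Finset (Sym2 (Fin n))}
    (h : ∀ p ∈ smallPairs n d, ¬ Trapped L C p) (v : Fin n) : ∃ u ∈ L v, s(v, u) ∈ C := by
  by_contra! hno
  refine h ({v}, {v}) (mem_smallPairs.2 ⟨Subset.rfl, by simp, ?_, by simpa using hn⟩) ?_
  · simp
    linarith
  · intro a ha u hu hau
    rw [mem_singleton.1 ha] at hu hau
    exact absurd hau (hno u hu)

/-- Vertices in `T₁`, in `T₂` and elsewhere have all their own neighbours in `T₂`, `Y`, `T₁`. -/
def cyclicNeighbors (T₁ T₂ Y : Finset (Fin n)) (v : Fin n) : Finset (Fin n) :=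
  if v ∈ T₁ then T₂ else if v ∈ T₂ then Y else T₁

theorem cyclicNeighbors_asymm {T₁ T₂ Y : Finset (Fin n)} (h12 : Disjoint T₁ T₂)
    (h1 : Disjoint T₁ Y) (h2 : Disjoint T₂ Y) (v u : Fin n)
    (hu : u ∈ cyclicNeighbors T₁ T₂ Y v) : v ∉ cyclicNeighbors T₁ T₂ Y u := by
  rw [disjoint_left] at h12 h1 h2
  have := @h12 u
  have := @h1 u
  have := @h2 u
  have := @h12 v
  have := @h1 v
  have := @h2 v
  unfold cyclicNeighbors at *
  split_ifs at * <;> tauto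

/-- The cyclic pattern alone need not connect the graph; the attachment of `T₂` to the path breaks
the circle. -/
theorem connected_of_cyclicNeighbors {T₁ T₂ Y : Finset (Fin n)} {m : ℕ}
    {x : ℕ → Fin n} {C : Finset (Sym2 (Fin n))} (hx : Set.InjOn x (Set.Iio m))
    (hpath : ∀ i, i + 1 < m → s(x i, x (i + 1)) ∈ C)
    (hattach : ∀ v ∈ T₂, ∃ i < m, v ≠ x i ∧ s(v, x i) ∈ C)
    (hown : ∀ v, ∃ u ∈ cyclicNeighbors T₁ T₂ Y v, v ≠ u ∧ s(v, u) ∈ C) :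
    (graphOf C).Connected := by
  have hpre : ∀ i < m, (graphOf C).Reachable (x i) (x 0) := by
    intro i
    induction i with
    | zero => exact fun _ => SimpleGraph.Reachable.refl _
    | succ i ih =>
      intro hi
      refine ((graphOf_adj (hpath i hi) fun h => ?_).symm.reachable).trans (ih (by omega))
      have := hx (Set.mem_Iio.2 (by omega)) (Set.mem_Iio.2 hi) h
      omega
  have h2 : ∀ v ∈ T₂, (graphOf C).Reachable v (x 0) := by
    intro v hv
    obtain ⟨i, hi, hne, hC⟩ := hattach v hv
    exact (graphOf_adj hC hne).reachable.trans (hpre i hi)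
  have h1 : ∀ v ∈ T₁, (graphOf C).Reachable v (x 0) := by
    intro v hv
    obtain ⟨u, hu, hne, hC⟩ := hown v
    rw [cyclicNeighbors, if_pos hv] at hu
    exact (graphOf_adj hC hne).reachable.trans (h2 u hu)
  have h0 : ∀ v, (graphOf C).Reachable v (x 0) := by
    intro v
    by_cases hv1 : v ∈ T₁
    · exact h1 v hv1
    by_cases hv2 : v ∈ T₂
    · exact h2 v hv2
    obtain ⟨u, hu, hne, hC⟩ := hown v
    rw [cyclicNeighbors, if_neg hv1, if_neg hv2] at hu
    exact (graphOf_adj hC hne).reachable.trans (h1 u hu)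
  have : Nonempty (Fin n) := ⟨x 0⟩
  exact ⟨fun u v => (h0 u).trans (h0 v).symm⟩

/-- Waiter's strategy on disjoint sets `W`, `Z`, `T₁`, `T₂`, `Y`. -/
theorem forces_target {W Z T₁ T₂ Y : Finset (Fin n)} (hWZ : Disjoint W Z)
    (hW1 : Disjoint W T₁) (hW2 : Disjoint W T₂) (hWY : Disjoint W Y)
    (hZ1 : Disjoint Z T₁) (hZ2 : Disjoint Z T₂) (hZY : Disjoint Z Y)
    (h12 : Disjoint T₁ T₂) (h1 : Disjoint T₁ Y) (h2 : Disjoint T₂ Y)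
    {d : ℝ} (hd : 2 ≤ d) (hn : 40 ≤ n) {K M D : ℕ} (hK : 0 < K) (hM : n ≤ 5 * M) (hD : 5 * d ≤ D)
    (hW : 2 * q + K ≤ W.card) (hZ : 2 * q + 1 ≤ Z.card) (hT₁ : M + D * (q + 1) ≤ T₁.card)
    (hT₂ : M + D * (q + 1) ≤ T₂.card) (hY : M + D * (q + 1) ≤ Y.card) :
    Forces (edgeBoard n) q (fun C _ =>
        IsExpander (graphOf C) (d / 2 - 1) (1 / (20 * d)) ∧
        (∀ k : ℕ, 3 ≤ k → k ≤ K → HasCycleOfLength (graphOf C) k) ∧ (graphOf C).Connected)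
      (q + K + (q + 1 + (K - 2 + (T₂.card + D * n)))) ∅ ∅ := by
  have hne : ∀ {A B : Finset (Fin n)}, Disjoint A B → ∀ a ∈ A, ∀ b ∈ B, a ≠ b :=
    fun h a ha b hb hab => disjoint_left.1 h ha (hab ▸ hb)
  refine (forces_path (W := W) (m := q + K) (by omega) (by omega)).trans ?_
  rintro C₁ O₁ ⟨x, hx, hxW, hxC, hO₁⟩
  refine (forces_pendants (C₀ := C₁) hWZ hZ (by omega) hx hxW hO₁).trans ?_
  rintro C₂ O₂ ⟨z, hC₂, hz, hzZ, hxz, hfree, hO₂⟩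
  refine (forces_chords (N := K - 2) (C₀ := C₂) hWZ (by omega) hx hxW hz hzZ hO₂ hfree).trans ?_
  rintro C₃ O₃ ⟨hC₃, hchord, hO₃⟩
  have hBW : ∀ b ∈ (range (q + 1)).image x, b ∈ W := by
    intro b hb
    obtain ⟨i, hi, rfl⟩ := mem_image.1 hb
    exact hxW i (by have := mem_range.1 hi; omega)
  refine (forces_attach (B := (range (q + 1)).image x) (T := T₂) (C₀ := C₃) (O₀ := O₃)
    (hW2.mono_left hBW) ?_ ?_).trans ?_
  · rw [card_image_of_injOn (hx.mono fun i hi => ?_), card_range]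
    simp only [coe_range, Set.mem_Iio] at hi ⊢
    omega
  · intro v hv b hb h
    rcases mem_union.1 (mk_mem_sym2_iff.1 (hO₃ h)).1 with h | h
    · exact hne hW2 _ h _ hv rfl
    · exact hne hZ2 _ h _ hv rfl
  rintro C₄ O₄ ⟨hC₄, hatt, hO₄⟩
  have hL := cyclicNeighbors_asymm h12 h1 h2
  have hLne : ∀ v, ∀ u ∈ cyclicNeighbors T₁ T₂ Y v, v ≠ u := by
    rintro v u hu rfl
    exact hL v v hu hu
  -- The first three stages stay inside `W ∪ Z`, which misses every target set. Attachments run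
  -- between `T₂` and `W`, whereas vertices of `W` own edges to `T₁` and those of `T₂` own edges to
  -- `Y`.
  have hLO : ∀ v, ∀ u ∈ cyclicNeighbors T₁ T₂ Y v, s(v, u) ∉ O₄ := by
    intro v u hu hmem
    have hu' : u ∈ T₁ ∨ u ∈ T₂ ∨ u ∈ Y := by
      unfold cyclicNeighbors at hu
      split_ifs at hu <;> tauto
    rcases hO₄ _ hmem with hmem | ⟨a, ha, b, hb, he⟩
    · rcases mem_union.1 (mk_mem_sym2_iff.1 (hO₃ hmem)).2 with h | h <;>
      rcases hu' with hu' | hu' | hu'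
      exacts [hne hW1 _ h _ hu' rfl, hne hW2 _ h _ hu' rfl, hne hWY _ h _ hu' rfl,
        hne hZ1 _ h _ hu' rfl, hne hZ2 _ h _ hu' rfl, hne hZY _ h _ hu' rfl]
    · have hbW := hBW b hb
      rcases Sym2.eq_iff.1 he with ⟨rfl, rfl⟩ | ⟨rfl, rfl⟩
      · rcases hu' with hu' | hu' | hu'
        exacts [hne hW1 _ hbW _ hu' rfl, hne hW2 _ hbW _ hu' rfl, hne hWY _ hbW _ hu' rfl]
      · rw [cyclicNeighbors, if_neg (disjoint_left.1 hW1 hbW),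
          if_neg (disjoint_left.1 hW2 hbW)] at hu
        exact hne h12 _ hu _ ha rfl
  refine (forces_escape (C := C₄) hL (by omega) hM hD hLO ?_).imp ?_
  · intro v
    unfold cyclicNeighbors
    split_ifs <;> assumption
  rintro C O ⟨hC, htrap⟩
  have h1C : C₁ ⊆ C := ((hC₂.trans hC₃).trans hC₄).trans hC
  have hpath : ∀ i, i + 1 < q + K → s(x i, x (i + 1)) ∈ C := fun i hi => h1C (hxC i hi)
  refine ⟨isExpander_of_not_trapped (by linarith) htrap, ?_, ?_⟩
  · intro k hk3 hkK
    obtain ⟨s, rfl⟩ : ∃ s, k = s + 3 := ⟨k - 3, by omega⟩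
    obtain ⟨i, hi, hmem⟩ := hchord s (by omega)
    refine hasCycleOfLength_of_path (m := q + K) (x := x) (z := z i) (i := i) hx
      (fun j hj => graphOf_adj (hpath j hj) fun h => ?_)
      (fun j hj => hne hWZ _ (hxW j hj) _ (hzZ i hi)) (by omega)
      (graphOf_adj (hC (hC₄ (hC₃ (hxz i hi)))) (hne hWZ _ (hxW i (by omega)) _ (hzZ i hi)))
      (graphOf_adj (hC (hC₄ hmem)) (hne hWZ _ (hxW _ (by omega)) _ (hzZ i hi)))
    have := hx (Set.mem_Iio.2 (by omega)) (Set.mem_Iio.2 hj) h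
    omega
  · refine connected_of_cyclicNeighbors (T₁ := T₁) (T₂ := T₂) (Y := Y) hx hpath ?_ ?_
    · intro v hv
      obtain ⟨b, hb, hmem⟩ := hatt v hv
      have hbW := hBW b hb
      obtain ⟨i, hi, rfl⟩ := mem_image.1 hb
      exact ⟨i, by have := mem_range.1 hi; omega, (hne hW2 _ hbW _ hv).symm, hC hmem⟩
    · intro v
      obtain ⟨u, hu, hmem⟩ := exists_edge_of_not_trapped hd hn htrap v
      exact ⟨u, hu, hLne v u hu, hmem⟩

theorem exists_disjoint_of_card_add_le {α : Type*} [DecidableEq α] [Fintype α] (F : Finset α)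
    (k : ℕ) (h : F.card + k ≤ Fintype.card α) :
    ∃ A : Finset α, Disjoint F A ∧ A.card = k := by
  obtain ⟨A, hA, hc⟩ := exists_subset_card_eq (s := Fᶜ) (n := k) (by rw [card_compl]; omega)
  exact ⟨A, (disjoint_compl_right (a := F)).mono_right hA, hc⟩

end WaiterClient

/-! ### Choice of constants -/

open WaiterClient in
theorem mainTheorem5 (d : ℝ) (hd : 4 ≤ d) :
    ∃ N : ℕ, ∀ n : ℕ, N ≤ n → ∀ q : ℕ, (q : ℝ) ≤ (n : ℝ) / (1000 * d) →
      ∃ σ : WaiterClient.WaiterStrategy (WaiterClient.edgeBoard n) q,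
        ∀ τ : WaiterClient.ClientStrategy (Sym2 (Fin n)),
          ∃ t : ℕ, (t : ℝ) ≤ 200 * (n : ℝ) * d ∧
            WaiterClient.IsExpander (WaiterClient.clientGraph σ τ t) (d / 2 - 1) (1 / (20 * d)) ∧
            (∀ k : ℕ, 3 ≤ k → k ≤ ⌈(n : ℝ) / 6⌉₊ →
              WaiterClient.HasCycleOfLength (WaiterClient.clientGraph σ τ t) k) ∧
            (WaiterClient.clientGraph σ τ t).Connected := by
  refine ⟨⌈1000 * d⌉₊, fun n hn q hq => ?_⟩
  have hn' : 1000 * d ≤ n := (Nat.le_ceil _).trans (by exact_mod_cast hn)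
  have hq1 : d * q ≤ n / 1000 := by
    rw [le_div_iff₀ (by positivity)] at hq
    linarith
  have hq2 : (q : ℝ) ≤ n / 4000 := by nlinarith [Nat.cast_nonneg (α := ℝ) q]
  set K := ⌈(n : ℝ) / 6⌉₊ with hKdef
  set M := ⌈(n : ℝ) / 5⌉₊ with hMdef
  set D := ⌈5 * d⌉₊ with hDdef
  have hK0 : 0 < K := Nat.ceil_pos.2 (by linarith)
  have hK : (K : ℝ) ≤ n / 6 + 1 := (Nat.ceil_lt_add_one (by positivity)).le
  have hM1 : (n : ℝ) / 5 ≤ M := Nat.le_ceil _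
  have hM2 : (M : ℝ) ≤ n / 5 + 1 := (Nat.ceil_lt_add_one (by positivity)).le
  have hD1 : 5 * d ≤ D := Nat.le_ceil _
  have hD2 : (D : ℝ) ≤ 5 * d + 1 := (Nat.ceil_lt_add_one (by positivity)).le
  have hDq : (D : ℝ) * (q + 1) ≤ n / 200 + n / 4000 + 5 * d + 1 := by
    calc (D : ℝ) * (q + 1) ≤ (5 * d + 1) * (q + 1) := by gcongr
      _ = 5 * (d * q) + q + 5 * d + 1 := by ring
      _ ≤ _ := by linarith
  -- The main terms are `n / 6` for `W` and `n / 5` for each of `T₁`, `T₂`, `Y`; `n ≥ 1000 * d`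
  -- absorbs the rounding and the terms in `d`.
  have hsize : 2 * q + K + (2 * q + 1) + 3 * (M + D * (q + 1)) ≤ n := by
    have : (2 * q + K + (2 * q + 1) + 3 * (M + D * (q + 1)) : ℝ) ≤ n := by linarith
    exact_mod_cast this
  have hcard : Fintype.card (Fin n) = n := Fintype.card_fin n
  obtain ⟨W, -, hW⟩ := exists_disjoint_of_card_add_le (∅ : Finset (Fin n)) (2 * q + K)
    (by rw [hcard, Finset.card_empty]; omega)
  obtain ⟨Z, hWZ, hZ⟩ := exists_disjoint_of_card_add_le W (2 * q + 1) (by omega)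
  have c1 := Finset.card_union_le W Z
  obtain ⟨T₁, hd1, hT₁⟩ := exists_disjoint_of_card_add_le (W ∪ Z) (M + D * (q + 1)) (by omega)
  have c2 := Finset.card_union_le (W ∪ Z) T₁
  obtain ⟨T₂, hd2, hT₂⟩ := exists_disjoint_of_card_add_le (W ∪ Z ∪ T₁) (M + D * (q + 1)) (by omega)
  have c3 := Finset.card_union_le (W ∪ Z ∪ T₁) T₂
  obtain ⟨Y, hd3, hY⟩ := exists_disjoint_of_card_add_le (W ∪ Z ∪ T₁ ∪ T₂) (M + D * (q + 1))
    (by omega)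
  simp only [Finset.disjoint_union_left] at hd1 hd2 hd3
  obtain ⟨σ, hσ⟩ := exists_strategy_of_forces (forces_target (q := q) hWZ hd1.1 hd2.1.1
    hd3.1.1.1 hd1.2 hd2.1.2 hd3.1.1.2 hd2.2 hd3.1.2 hd3.2 (d := d) (by linarith)
    (by have : (40 : ℝ) ≤ n := by linarith
        exact_mod_cast this) hK0 (M := M) (D := D)
    (by have : (n : ℝ) ≤ 5 * M := by linarith
        exact_mod_cast this) hD1 hW.ge hZ.ge hT₁.ge hT₂.ge hY.ge)
  refine ⟨σ, fun τ => ?_⟩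
  obtain ⟨t, ht, h⟩ := hσ τ
  refine ⟨t, ?_, h⟩
  -- All rounds except the `D * n` own-edge rounds number at most twice the total in `hsize`.
  have ht' : t ≤ 2 * n + D * n := by omega
  calc (t : ℝ) ≤ 2 * n + D * n := by exact_mod_cast ht'
    _ ≤ 2 * n + (5 * d + 1) * n := by gcongr
    _ ≤ 200 * n * d := by nlinarith [Nat.cast_nonneg (α := ℝ) n]
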